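/- Let $d\ge 1$ and $k\in\{1,\dots,d\}$ be integers, and let $1<p<\infty$. For $r\in[1,\infty]$ let $\|\cdot\|_r$ be the $\ell_r$-norm on $\mathbb{R}^d$ and $\|y\|_{r,*}=\sup\{\langle x,y\rangle : \|x\|_r\le 1\}$ its dual norm. For $K\subset\{1,\dots,d\}$ let $\pi_K$ be the orthogonal projection of $\mathbb{R}^d$ that sets to zero the coordinates outside $K$. Let $B_{r,k}$ be the unit ball of the $(r,k)$-support norm, that is, of the norm $$x\mapsto \sup\Bigl\{\langle x,y\rangle : y\in\mathbb{R}^d,\ \max_{|K|\le k}\|\pi_K y\|_{r,*}\le 1\Bigr\}.$$ For a closed convex set $C\subset\mathbb{R}^d$ and $y\in\mathbb{R}^d$, let $F_\perp(C,y)$ be the set of the maximizers of $x\mapsto\langle x,y\rangle$ over $C$. The exposed faces of $C$ are the empty set and the sets $F_\perp(C,y)$ with $y\in\mathbb{R}^d$. The normal cone of $C$ at an exposed face $F$ is the closure of $\{y\in\mathbb{R}^d : F_\perp(C,y)=F\}$, and the normal fan $\mathcal{N}(C)$ of $C$ is the set of its normal cones at its exposed faces. Then $\mathcal{N}(B_{p,k})$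 refines $\mathcal{N}(B_{\infty,k})$: every cone of $\mathcal{N}(B_{p,k})$ is contained in a cone of $\mathcal{N}(B_{\infty,k})$, and the two families of cones have the same union. -/

import Mathlib

open scoped ENNReal

noncomputable section

namespace KSupport

variable {d : ℕ}

/-- The `ℓ_p`-norm on `ℝ^d`, for `p ∈ [1, ∞]`. -/
def lpNorm (p : ℝ≥0∞) (x : EuclideanSpace ℝ (Fin d)) : ℝ :=
  ‖(WithLp.toLp p (fun i => x i) : PiLp p (fun _ : Fin d => ℝ))‖

/-- The dual norm `y ↦ sup {⟨x, y⟩ : N x ≤ 1}` of a norm `N` on `ℝ^d`. -/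
def dualNorm (N : EuclideanSpace ℝ (Fin d) → ℝ) (y : EuclideanSpace ℝ (Fin d)) : ℝ :=
  sSup ((fun x => inner ℝ x y) '' {x | N x ≤ 1})

/-- The orthogonal projection onto the vectors that vanish outside of `K`. -/
def coordProj (K : Finset (Fin d)) (x : EuclideanSpace ℝ (Fin d)) : EuclideanSpace ℝ (Fin d) :=
  WithLp.toLp 2 (fun i => if i ∈ K then x i else 0)

/-- The generalized top-`k` dual norm of the source norm `N`: the largest dual norm of a
projection onto at most `k` coordinates. -/
def topDualNorm (N : EuclideanSpace ℝ (Fin d) → ℝ) (k : ℕ) (y : EuclideanSpace ℝ (Fin d)) : ℝ :=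
  ⨆ K : {K : Finset (Fin d) // K.card ≤ k}, dualNorm N (coordProj K.1 y)

/-- The generalized `k`-support dual norm of the source norm `N`: the dual norm of the
generalized top-`k` dual norm. -/
def supportDualNorm (N : EuclideanSpace ℝ (Fin d) → ℝ) (k : ℕ) :
    EuclideanSpace ℝ (Fin d) → ℝ :=
  dualNorm (topDualNorm N k)

/-- The unit ball of the `(p,k)`-support norm on `ℝ^d`. -/
def lpSupportBall (d : ℕ) (p : ℝ≥0∞) (k : ℕ) : Set (EuclideanSpace ℝ (Fin d)) :=
  {x | supportDualNorm (lpNorm p) k x ≤ 1}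

/-- The face of `C` exposed by `y`: the maximizers of `x ↦ ⟨x, y⟩` over `C`. -/
def exposedFace (C : Set (EuclideanSpace ℝ (Fin d))) (y : EuclideanSpace ℝ (Fin d)) :
    Set (EuclideanSpace ℝ (Fin d)) :=
  {x ∈ C | ∀ z ∈ C, inner ℝ z y ≤ inner ℝ x y}

/-- The normal cone of `C` at `F`: the closure of the set of vectors that expose `F`. -/
def normalCone (C F : Set (EuclideanSpace ℝ (Fin d))) : Set (EuclideanSpace ℝ (Fin d)) :=
  closure {y | exposedFace C y = F}

/-- The normal fan of `C`: the set of the normal cones of `C` at its exposed faces. The empty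
set counts as an exposed face in `IsExposed`; its normal cone is empty. -/
def normalFan (C : Set (EuclideanSpace ℝ (Fin d))) : Set (Set (EuclideanSpace ℝ (Fin d))) :=
  {N | ∃ F, IsExposed ℝ C F ∧ N = normalCone C F}

/-- `𝒜` refines `ℬ`: every cone of `𝒜` is contained in a cone of `ℬ`, and both families
cover the same set. -/
def FanRefines (𝒜 ℬ : Set (Set (EuclideanSpace ℝ (Fin d)))) : Prop :=
  (∀ A ∈ 𝒜, ∃ B ∈ ℬ, A ⊆ B) ∧ ⋃₀ 𝒜 = ⋃₀ ℬ

end KSupport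

end

open scoped ENNReal

noncomputable section

namespace KSupport

variable {d : ℕ}

/-! With `q` conjugate to `p`, the support function of the unit ball is `T y`, the `ℓ_q`-norm of the
`k` largest `|y i|` (`IsTop.topDualNorm_eq`, `inner_le_topDualNorm`), and the face exposed by `y` is
where `⟨x, y⟩ = T y`. For `q > 0`, the face determines the top-`k` sets of `y` and the signs of `y`
on them: a norming vector supported on a top set lies in the face, and the equality it satisfies for
any other `y'` exposing that face forces the data to agree (`IsTop.of_exposedFace_subset`). For `p =
∞`, `q = 1`, these data determine the face: if `y`, `y'` share them, then `T y = T (y - ε y') + ε T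
y'` for small `ε > 0`, so a maximizer for `y` is one for `y'` (`exposedFace_top_subset`). Hence
equal faces for `p` give equal faces for `∞`, and taking closures gives the refinement. -/

/-- The sum of the `q`-th powers of the absolute values of the coordinates in `K`. -/
def powSum (q : ℝ) (y : EuclideanSpace ℝ (Fin d)) (K : Finset (Fin d)) : ℝ :=
  ∑ i ∈ K, |y i| ^ q

/-- `K` consists of the positions of `k` largest absolute values of coordinates of `y`. -/
def IsTop (k : ℕ) (y : EuclideanSpace ℝ (Fin d)) (K : Finset (Fin d)) : Prop :=
  K.card = k ∧ ∀ i ∈ K, ∀ j ∉ K, |y j| ≤ |y i|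

/-- `q` is an exponent of the norm dual to the `ℓ_p`-norm, on every set of coordinates, with
norming vectors that have the signs of the given vector. -/
def IsLpDual (d : ℕ) (p : ℝ≥0∞) (q : ℝ) : Prop :=
  (∀ (x y : EuclideanSpace ℝ (Fin d)) (K : Finset (Fin d)), lpNorm p x ≤ 1 →
    ∑ i ∈ K, x i * y i ≤ powSum q y K ^ (1 / q)) ∧
  (∀ (y : EuclideanSpace ℝ (Fin d)) (K : Finset (Fin d)), ∃ x : EuclideanSpace ℝ (Fin d),
    lpNorm p x ≤ 1 ∧ (∀ i ∉ K, x i = 0) ∧ ∑ i ∈ K, x i * y i = powSum q y K ^ (1 / q) ∧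
    ∀ i, ∃ c : ℝ, 0 ≤ c ∧ x i = c * y i)

/-! ### Power sums and top-`k` sets -/

theorem inner_eq_sum (x y : EuclideanSpace ℝ (Fin d)) : inner ℝ x y = ∑ i, x i * y i := by
  simp [PiLp.inner_apply, mul_comm]

theorem sum_eq_inner_of_support {x : EuclideanSpace ℝ (Fin d)} {K : Finset (Fin d)}
    (hx : ∀ i ∉ K, x i = 0) (y : EuclideanSpace ℝ (Fin d)) :
    inner ℝ x y = ∑ i ∈ K, x i * y i := by
  rw [inner_eq_sum]
  symm
  apply Finset.sum_subset (Finset.subset_univ K)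
  intro i _ hi
  rw [hx i hi, zero_mul]

theorem inner_coordProj (x y : EuclideanSpace ℝ (Fin d)) (K : Finset (Fin d)) :
    inner ℝ x (coordProj K y) = ∑ i ∈ K, x i * y i := by
  rw [inner_eq_sum]
  simp [coordProj, Finset.sum_ite_mem]

theorem powSum_nonneg (q : ℝ) (y : EuclideanSpace ℝ (Fin d)) (K : Finset (Fin d)) :
    0 ≤ powSum q y K :=
  Finset.sum_nonneg fun _ _ => Real.rpow_nonneg (abs_nonneg _) _

theorem powSum_mono (q : ℝ) (y : EuclideanSpace ℝ (Fin d)) {K L : Finset (Fin d)} (h : K ⊆ L) :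
    powSum q y K ≤ powSum q y L :=
  Finset.sum_le_sum_of_subset_of_nonneg h fun _ _ _ => Real.rpow_nonneg (abs_nonneg _) _

theorem powSum_smul (q : ℝ) {c : ℝ} (hc : 0 ≤ c) (y : EuclideanSpace ℝ (Fin d))
    (K : Finset (Fin d)) : powSum q (c • y) K = c ^ q * powSum q y K := by
  unfold powSum
  rw [Finset.mul_sum]
  refine Finset.sum_congr rfl fun i _ => ?_
  rw [PiLp.smul_apply, smul_eq_mul, abs_mul, abs_of_nonneg hc, Real.mul_rpow hc (abs_nonneg _)]

theorem powSum_insert_erase (q : ℝ) (y : EuclideanSpace ℝ (Fin d)) {K : Finset (Fin d)}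
    {i j : Fin d} (hi : i ∈ K) (hj : j ∉ K) :
    powSum q y (insert j (K.erase i)) + |y i| ^ q = powSum q y K + |y j| ^ q := by
  have hj' : j ∉ K.erase i := fun h => hj (Finset.mem_of_mem_erase h)
  unfold powSum
  rw [Finset.sum_insert hj', ← Finset.sum_erase_add K (fun i => |y i| ^ q) hi]
  ring

theorem card_insert_erase {K : Finset (Fin d)} {i j : Fin d} (hi : i ∈ K) (hj : j ∉ K) :
    (insert j (K.erase i)).card = K.card := by
  have hj' : j ∉ K.erase i := fun h => hj (Finset.mem_of_mem_erase h)
  rw [Finset.card_insert_of_notMem hj', Finset.card_erase_add_one hi]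

/-- Each term of `L \ K` is at most the least term of `K`, and `L \ K` has no more elements than `K
\ L`. -/
theorem IsTop.powSum_le {k : ℕ} {y : EuclideanSpace ℝ (Fin d)} {K L : Finset (Fin d)} {q : ℝ}
    (hq : 0 < q) (hk : 1 ≤ k) (hK : IsTop k y K) (hL : L.card ≤ k) :
    powSum q y L ≤ powSum q y K := by
  have hne : K.Nonempty := by
    rw [← Finset.card_pos, hK.1]
    exact hk
  obtain ⟨m, hm, hmin⟩ := Finset.exists_min_image K (fun i => |y i| ^ q) hne
  have hcard : (L \ K).card ≤ (K \ L).card :=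
    Finset.card_sdiff_le_card_sdiff_iff.mpr (hL.trans hK.1.ge)
  have h₁ : ∑ i ∈ L \ K, |y i| ^ q ≤ (L \ K).card • |y m| ^ q := by
    refine Finset.sum_le_card_nsmul _ _ _ fun i hi => ?_
    exact Real.rpow_le_rpow (abs_nonneg _) (hK.2 m hm i (Finset.mem_sdiff.mp hi).2) hq.le
  have h₂ : (K \ L).card • |y m| ^ q ≤ ∑ i ∈ K \ L, |y i| ^ q :=
    Finset.card_nsmul_le_sum _ _ _ fun i hi => hmin i (Finset.mem_sdiff.mp hi).1
  have h₃ : (L \ K).card • |y m| ^ q ≤ (K \ L).card • |y m| ^ q :=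
    nsmul_le_nsmul_left (Real.rpow_nonneg (abs_nonneg _) _) hcard
  have e₁ := Finset.sum_inter_add_sum_sdiff L K (fun i => |y i| ^ q)
  have e₂ := Finset.sum_inter_add_sum_sdiff K L (fun i => |y i| ^ q)
  rw [Finset.inter_comm] at e₂
  unfold powSum
  linarith

/-- Exchange argument: replacing `i ∈ K` by `j ∉ K` must not increase the power sum. -/
theorem isTop_of_powSum_le {k : ℕ} {y : EuclideanSpace ℝ (Fin d)} {K : Finset (Fin d)} {q : ℝ}
    (hq : 0 < q) (hK : K.card = k) (h : ∀ L, L.card = k → powSum q y L ≤ powSum q y K) :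
    IsTop k y K := by
  refine ⟨hK, fun i hi j hj => ?_⟩
  have h₁ := h _ ((card_insert_erase hi hj).trans hK)
  have h₂ := powSum_insert_erase q y hi hj
  exact (Real.rpow_le_rpow_iff (abs_nonneg _) (abs_nonneg _) hq).mp (by linarith)

theorem exists_isTop {k : ℕ} (hkd : k ≤ d) (y : EuclideanSpace ℝ (Fin d)) :
    ∃ K, IsTop k y K := by
  have hne : (Finset.powersetCard k (Finset.univ : Finset (Fin d))).Nonempty := by
    rw [Finset.powersetCard_nonempty]
    simpa using hkd
  obtain ⟨K, hK, hmax⟩ := Finset.exists_max_image _ (powSum 1 y) hne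
  refine ⟨K, isTop_of_powSum_le one_pos (Finset.mem_powersetCard.mp hK).2 fun L hL => hmax L ?_⟩
  exact Finset.mem_powersetCard.mpr ⟨Finset.subset_univ _, hL⟩

theorem IsTop.swap {k : ℕ} {y : EuclideanSpace ℝ (Fin d)} {K : Finset (Fin d)} (hk : 1 ≤ k)
    (hK : IsTop k y K) {i j : Fin d} (hi : i ∈ K) (hj : j ∉ K) (hij : |y j| = |y i|) :
    IsTop k y (insert j (K.erase i)) := by
  refine isTop_of_powSum_le one_pos ((card_insert_erase hi hj).trans hK.1) fun L hL => ?_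
  have h₁ := hK.powSum_le one_pos hk hL.le
  have h₂ := powSum_insert_erase 1 y hi hj
  rw [hij] at h₂
  linarith

theorem IsTop.smul {k : ℕ} {y : EuclideanSpace ℝ (Fin d)} {K : Finset (Fin d)}
    (hK : IsTop k y K) (c : ℝ) : IsTop k (c • y) K := by
  refine ⟨hK.1, fun i hi j hj => ?_⟩
  simpa [abs_mul] using mul_le_mul_of_nonneg_left (hK.2 i hi j hj) (abs_nonneg c)

/-! ### Support function and exposed faces of the ball -/

theorem dualNorm_coordProj {p : ℝ≥0∞} {q : ℝ} (h : IsLpDual d p q)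
    (y : EuclideanSpace ℝ (Fin d)) (K : Finset (Fin d)) :
    dualNorm (lpNorm p) (coordProj K y) = powSum q y K ^ (1 / q) := by
  apply IsGreatest.csSup_eq
  constructor
  · obtain ⟨x, hx, -, hxy, -⟩ := h.2 y K
    exact ⟨x, hx, (inner_coordProj x y K).trans hxy⟩
  · rintro _ ⟨x, hx, rfl⟩
    exact (inner_coordProj x y K).trans_le (h.1 x y K hx)

theorem powSum_rpow_le_topDualNorm {p : ℝ≥0∞} {q : ℝ} (h : IsLpDual d p q) {k : ℕ}
    (y : EuclideanSpace ℝ (Fin d)) {K : Finset (Fin d)} (hK : K.card ≤ k) :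
    powSum q y K ^ (1 / q) ≤ topDualNorm (lpNorm p) k y := by
  rw [← dualNorm_coordProj h]
  exact le_ciSup (f := fun K : {K : Finset (Fin d) // K.card ≤ k} =>
    dualNorm (lpNorm p) (coordProj K.1 y)) (Set.finite_range _).bddAbove ⟨K, hK⟩

theorem IsTop.topDualNorm_eq {p : ℝ≥0∞} {q : ℝ} (h : IsLpDual d p q) (hq : 0 < q) {k : ℕ}
    (hk : 1 ≤ k) {y : EuclideanSpace ℝ (Fin d)} {K : Finset (Fin d)} (hK : IsTop k y K) :
    topDualNorm (lpNorm p) k y = powSum q y K ^ (1 / q) := by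
  apply le_antisymm _ (powSum_rpow_le_topDualNorm h y hK.1.le)
  have : Nonempty {K : Finset (Fin d) // K.card ≤ k} := ⟨⟨K, hK.1.le⟩⟩
  refine ciSup_le fun L => ?_
  rw [dualNorm_coordProj h]
  exact Real.rpow_le_rpow (powSum_nonneg _ _ _) (hK.powSum_le hq hk L.2) (by positivity)

theorem abs_le_topDualNorm {p : ℝ≥0∞} {q : ℝ} (h : IsLpDual d p q) (hq : 0 < q) {k : ℕ}
    (hk : 1 ≤ k) (y : EuclideanSpace ℝ (Fin d)) (i : Fin d) :
    |y i| ≤ topDualNorm (lpNorm p) k y := by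
  have h₁ := powSum_rpow_le_topDualNorm h (k := k) y (K := {i}) (by simpa using hk)
  rwa [powSum, Finset.sum_singleton, ← Real.rpow_mul (abs_nonneg _),
    mul_one_div_cancel hq.ne', Real.rpow_one] at h₁

theorem topDualNorm_smul {p : ℝ≥0∞} {q : ℝ} (h : IsLpDual d p q) (hq : 0 < q) {k : ℕ}
    (hk : 1 ≤ k) (hkd : k ≤ d) {c : ℝ} (hc : 0 ≤ c) (y : EuclideanSpace ℝ (Fin d)) :
    topDualNorm (lpNorm p) k (c • y) = c * topDualNorm (lpNorm p) k y := by
  obtain ⟨K, hK⟩ := exists_isTop hkd y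
  rw [hK.topDualNorm_eq h hq hk, (hK.smul c).topDualNorm_eq h hq hk, powSum_smul q hc,
    Real.mul_rpow (Real.rpow_nonneg hc _) (powSum_nonneg _ _ _), ← Real.rpow_mul hc,
    mul_one_div_cancel hq.ne', Real.rpow_one]

theorem inner_le_topDualNorm {p : ℝ≥0∞} {q : ℝ} (h : IsLpDual d p q) (hq : 0 < q) {k : ℕ}
    (hk : 1 ≤ k) (hkd : k ≤ d) {z : EuclideanSpace ℝ (Fin d)} (hz : z ∈ lpSupportBall d p k)
    (y : EuclideanSpace ℝ (Fin d)) : inner ℝ z y ≤ topDualNorm (lpNorm p) k y := by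
  have key : ∀ v, topDualNorm (lpNorm p) k v ≤ 1 → inner ℝ z v ≤ 1 := by
    intro v hv
    rw [real_inner_comm]
    refine (le_csSup ?_ (Set.mem_image_of_mem (fun x => inner ℝ x z) hv)).trans hz
    -- An unbounded real `sSup` would be `0`, so boundedness has to be shown; it follows from `|x i|
    -- ≤ T x ≤ 1`.
    refine ⟨∑ i, |z i|, ?_⟩
    rintro _ ⟨x, hx, rfl⟩
    simp only [inner_eq_sum]
    refine Finset.sum_le_sum fun i _ => (le_abs_self _).trans ?_
    rw [abs_mul]
    exact mul_le_of_le_one_left (abs_nonneg _) ((abs_le_topDualNorm h hq hk x i).trans hx)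
  obtain ⟨K, hK⟩ := exists_isTop hkd y
  have h0 : 0 ≤ topDualNorm (lpNorm p) k y := by
    rw [hK.topDualNorm_eq h hq hk]
    exact Real.rpow_nonneg (powSum_nonneg _ _ _) _
  rcases h0.eq_or_lt with h0 | h0
  · have hy : y = 0 := by
      ext i
      have := abs_le_topDualNorm h hq hk y i
      rw [← h0] at this
      simpa using this
    rw [← h0, hy, inner_zero_right]
  · have h₁ := key ((topDualNorm (lpNorm p) k y)⁻¹ • y) (by
      rw [topDualNorm_smul h hq hk hkd (by positivity), inv_mul_cancel₀ h0.ne'])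
    rwa [real_inner_smul_right, inv_mul_le_one₀ h0] at h₁

theorem mem_lpSupportBall_of_support {p : ℝ≥0∞} {q : ℝ} (h : IsLpDual d p q) {k : ℕ}
    {x : EuclideanSpace ℝ (Fin d)} (hx : lpNorm p x ≤ 1) {K : Finset (Fin d)} (hK : K.card ≤ k)
    (hxK : ∀ i ∉ K, x i = 0) : x ∈ lpSupportBall d p k := by
  refine Real.sSup_le ?_ zero_le_one
  rintro _ ⟨v, hv, rfl⟩
  change inner ℝ v x ≤ 1
  rw [real_inner_comm, sum_eq_inner_of_support hxK]
  exact (h.1 x v K hx).trans ((powSum_rpow_le_topDualNorm h v hK).trans hv)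

/-- The norming vector of `y` on `K` attains the bound of `inner_le_topDualNorm`. Its support and
signs are what lets the face reveal `K` and the signs of `y`. -/
theorem IsTop.exists_mem_exposedFace {p : ℝ≥0∞} {q : ℝ} (h : IsLpDual d p q) (hq : 0 < q)
    {k : ℕ} (hk : 1 ≤ k) (hkd : k ≤ d) {y : EuclideanSpace ℝ (Fin d)} {K : Finset (Fin d)}
    (hK : IsTop k y K) : ∃ x ∈ exposedFace (lpSupportBall d p k) y, lpNorm p x ≤ 1 ∧
      (∀ i ∉ K, x i = 0) ∧ inner ℝ x y = topDualNorm (lpNorm p) k y ∧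
      ∀ i, ∃ c : ℝ, 0 ≤ c ∧ x i = c * y i := by
  obtain ⟨x, hx, hxK, hxy, hc⟩ := h.2 y K
  have hT : inner ℝ x y = topDualNorm (lpNorm p) k y := by
    rw [sum_eq_inner_of_support hxK, hxy, hK.topDualNorm_eq h hq hk]
  refine ⟨x, ⟨mem_lpSupportBall_of_support h hx hK.1.le hxK, fun z hz => ?_⟩, hx, hxK, hT, hc⟩
  rw [hT]
  exact inner_le_topDualNorm h hq hk hkd hz y

theorem mem_exposedFace_iff {p : ℝ≥0∞} {q : ℝ} (h : IsLpDual d p q) (hq : 0 < q)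
    {k : ℕ} (hk : 1 ≤ k) (hkd : k ≤ d) {x y : EuclideanSpace ℝ (Fin d)} :
    x ∈ exposedFace (lpSupportBall d p k) y ↔
      x ∈ lpSupportBall d p k ∧ inner ℝ x y = topDualNorm (lpNorm p) k y := by
  constructor
  · rintro ⟨hx, hmax⟩
    obtain ⟨K, hK⟩ := exists_isTop hkd y
    obtain ⟨z, hz, -, -, hzy, -⟩ := hK.exists_mem_exposedFace h hq hk hkd
    exact ⟨hx, (inner_le_topDualNorm h hq hk hkd hx y).antisymm (hzy ▸ hmax z hz.1)⟩
  · rintro ⟨hx, hxy⟩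
    refine ⟨hx, fun z hz => ?_⟩
    rw [hxy]
    exact inner_le_topDualNorm h hq hk hkd hz y

/-- The largest coordinates of a vector, and their signs, are seen in the exposed face. -/
theorem IsTop.of_exposedFace_subset {p : ℝ≥0∞} {q : ℝ} (h : IsLpDual d p q) (hq : 0 < q)
    {k : ℕ} (hk : 1 ≤ k) (hkd : k ≤ d) {y y' : EuclideanSpace ℝ (Fin d)}
    (hF : exposedFace (lpSupportBall d p k) y ⊆ exposedFace (lpSupportBall d p k) y')
    {K : Finset (Fin d)} (hK : IsTop k y K) :
    IsTop k y' K ∧ ∀ i ∈ K, y' i = 0 ∨ 0 < y i * y' i := by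
  obtain ⟨x, hxF, hx, hxK, -, hc⟩ := hK.exists_mem_exposedFace h hq hk hkd
  have hxy' := ((mem_exposedFace_iff h hq hk hkd).mp (hF hxF)).2
  rw [sum_eq_inner_of_support hxK] at hxy'
  have hpos : 0 < 1 / q := by positivity
  have htop : ∀ L : Finset (Fin d), L.card ≤ k →
      powSum q y' L ^ (1 / q) ≤ ∑ i ∈ K, x i * y' i := fun L hL =>
    (powSum_rpow_le_topDualNorm h y' hL).trans hxy'.ge
  -- Hölder on `K` bounds `⟨x, y'⟩ = T y'` by the power sum over `K`, which is therefore maximal.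
  refine ⟨isTop_of_powSum_le hq hK.1 fun L hL => ?_, fun i hi => ?_⟩
  · rw [← Real.rpow_le_rpow_iff (powSum_nonneg _ _ _) (powSum_nonneg _ _ _) hpos]
    exact (htop L hL.le).trans (h.1 x y' K hx)
  -- Otherwise dropping `i` does not lower `∑ x i * y' i`, and Hölder on `K.erase i` makes that
  -- smaller set carry the whole power sum, although `y' i ≠ 0`.
  · by_contra! hcon
    obtain ⟨c, hc0, hci⟩ := hc i
    have hxi : x i * y' i ≤ 0 := by
      rw [hci, mul_assoc]
      exact mul_nonpos_of_nonneg_of_nonpos hc0 hcon.2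
    have h₁ := Finset.sum_erase_add K (fun i => x i * y' i) hi
    have h₂ := h.1 x y' (K.erase i) hx
    have h₃ := htop K hK.1.le
    have h₄ : powSum q y' K ≤ powSum q y' (K.erase i) := by
      rw [← Real.rpow_le_rpow_iff (powSum_nonneg _ _ _) (powSum_nonneg _ _ _) hpos]
      linarith
    have h₅ := Finset.sum_erase_add K (fun i => |y' i| ^ q) hi
    have h₆ : 0 < |y' i| ^ q := Real.rpow_pos_of_pos (abs_pos.mpr hcon.1) q
    unfold powSum at h₄
    linarith

theorem abs_sub_mul_of_sign {a b ε : ℝ} (hab : (a = 0 ∧ b = 0) ∨ 0 < a * b)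
    (hle : ε * |b| ≤ |a|) : |a - ε * b| = |a| - ε * |b| := by
  rcases hab with ⟨rfl, rfl⟩ | hab
  · simp
  · rcases mul_pos_iff.mp hab with ⟨ha, hb⟩ | ⟨ha, hb⟩
    · rw [abs_of_pos ha, abs_of_pos hb] at *
      exact abs_of_nonneg (by linarith)
    · rw [abs_of_neg ha, abs_of_neg hb] at *
      rw [abs_of_nonpos (by linarith)]
      ring

theorem eventually_mul_abs_le {a b : ℝ} (hab : (a = 0 ∧ b = 0) ∨ 0 < a * b) :
    ∀ᶠ ε in nhdsWithin (0 : ℝ) (Set.Ioi 0), ε * |b| ≤ |a| := by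
  rcases hab with ⟨rfl, rfl⟩ | hab
  · simp
  · have ha : 0 < |a| := abs_pos.mpr (left_ne_zero_of_mul hab.ne')
    have hcont : Continuous fun ε : ℝ => ε * |b| := by fun_prop
    have := hcont.continuousAt.eventually_lt (x₀ := 0) (g := fun _ => |a|)
      continuousAt_const (by simpa only [zero_mul] using ha)
    exact (this.filter_mono nhdsWithin_le_nhds).mono fun _ h => h.le

/-- Vectors with the same sets of `k` largest coordinates, and with the same signs there, expose
the same face of the unit ball of the `(⊤,k)`-support norm. -/
theorem exposedFace_top_subset (h : IsLpDual d ⊤ 1) {k : ℕ} (hk : 1 ≤ k) (hkd : k ≤ d)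
    {y y' : EuclideanSpace ℝ (Fin d)} (htop : ∀ K, IsTop k y K → IsTop k y' K)
    (hsign : ∀ K, IsTop k y K → ∀ i ∈ K, (y i = 0 ∧ y' i = 0) ∨ 0 < y i * y' i) :
    exposedFace (lpSupportBall d ⊤ k) y ⊆ exposedFace (lpSupportBall d ⊤ k) y' := by
  intro z hz
  rw [mem_exposedFace_iff h one_pos hk hkd] at hz ⊢
  refine ⟨hz.1, ?_⟩
  obtain ⟨K, hK⟩ := exists_isTop hkd y
  -- A small `ε` neither flips a sign on the top sets nor reverses a strict inequality between
  -- absolute values.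
  have hev : ∀ᶠ ε in nhdsWithin (0 : ℝ) (Set.Ioi 0),
      (∀ i, ((y i = 0 ∧ y' i = 0) ∨ 0 < y i * y' i) → ε * |y' i| ≤ |y i|) ∧
      (∀ i j, |y j| < |y i| → |y j - ε * y' j| ≤ |y i - ε * y' i|) ∧ 0 < ε := by
    refine Filter.Eventually.and ?_ (Filter.Eventually.and ?_ self_mem_nhdsWithin)
    · simp only [Filter.eventually_all]
      exact fun i => eventually_mul_abs_le
    · simp only [Filter.eventually_all]
      intro i j hij
      have hci : Continuous fun ε : ℝ => |y i - ε * y' i| := by fun_prop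
      have hcj : Continuous fun ε : ℝ => |y j - ε * y' j| := by fun_prop
      have := hcj.continuousAt.eventually_lt (x₀ := 0) hci.continuousAt (by simpa using hij)
      exact (this.filter_mono nhdsWithin_le_nhds).mono fun _ h => h.le
  obtain ⟨ε, hle, hlt, hε⟩ := hev.exists
  have habs : ∀ i, ((y i = 0 ∧ y' i = 0) ∨ 0 < y i * y' i) →
      |y i - ε * y' i| = |y i| - ε * |y' i| := fun i hi =>
    abs_sub_mul_of_sign hi (hle i hi)
  have hw : IsTop k (y - ε • y') K := by
    refine ⟨hK.1, fun i hi j hj => ?_⟩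
    simp only [PiLp.sub_apply, PiLp.smul_apply, smul_eq_mul]
    rcases (hK.2 i hi j hj).lt_or_eq with hij | hij
    · exact hlt i j hij
    -- On a tie, `K` and the swapped set are both top for `y`, hence for `y'`. So `|y' i| = |y' j|`,
    -- and the tie persists.
    · have hswap := hK.swap hk hi hj hij
      have hi' : i ∉ insert j (K.erase i) := by
        simp only [Finset.mem_insert, Finset.notMem_erase, or_false]
        rintro rfl
        exact hj hi
      have h₁ := (htop K hK).2 i hi j hj
      have h₂ := (htop _ hswap).2 j (Finset.mem_insert_self _ _) i hi'
      rw [habs i (hsign K hK i hi), habs j (hsign _ hswap j (Finset.mem_insert_self _ _)), hij,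
        h₁.antisymm h₂]
  -- All three norms are `ℓ_1`-sums over the same `K`, with compatible signs; this additivity is
  -- where `q = 1` matters.
  have hsum : topDualNorm (lpNorm ⊤) k y = topDualNorm (lpNorm ⊤) k (y - ε • y') +
      ε * topDualNorm (lpNorm ⊤) k y' := by
    rw [hK.topDualNorm_eq h one_pos hk, hw.topDualNorm_eq h one_pos hk,
      (htop K hK).topDualNorm_eq h one_pos hk]
    simp only [powSum, div_one, Real.rpow_one, Finset.mul_sum, ← Finset.sum_add_distrib]
    refine Finset.sum_congr rfl fun i hi => ?_
    simp only [PiLp.sub_apply, PiLp.smul_apply, smul_eq_mul]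
    rw [habs i (hsign K hK i hi)]
    ring
  have h₁ := inner_le_topDualNorm h one_pos hk hkd hz.1 (y - ε • y')
  have h₂ := inner_le_topDualNorm h one_pos hk hkd hz.1 y'
  have h₃ := hz.2
  rw [hsum] at h₃
  rw [inner_sub_right, real_inner_smul_right] at h₁
  refine h₂.antisymm (le_of_mul_le_mul_left ?_ hε)
  linarith

theorem exposedFace_top_eq {p : ℝ≥0∞} {q : ℝ} (h : IsLpDual d p q) (hq : 0 < q)
    (h' : IsLpDual d ⊤ 1) {k : ℕ} (hk : 1 ≤ k) (hkd : k ≤ d) {y y' : EuclideanSpace ℝ (Fin d)}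
    (hF : exposedFace (lpSupportBall d p k) y = exposedFace (lpSupportBall d p k) y') :
    exposedFace (lpSupportBall d ⊤ k) y = exposedFace (lpSupportBall d ⊤ k) y' := by
  have main : ∀ {u v : EuclideanSpace ℝ (Fin d)},
      exposedFace (lpSupportBall d p k) u = exposedFace (lpSupportBall d p k) v →
      exposedFace (lpSupportBall d ⊤ k) u ⊆ exposedFace (lpSupportBall d ⊤ k) v := by
    intro u v huv
    have huv' := fun K (hK : IsTop k u K) => hK.of_exposedFace_subset h hq hk hkd huv.le
    refine exposedFace_top_subset h' hk hkd (fun K hK => (huv' K hK).1) fun K hK i hi => ?_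
    have h₁ := (huv' K hK).2 i hi
    -- One inclusion still allows `v i = 0` with `u i ≠ 0`; the reverse inclusion rules this out.
    have h₂ := ((huv' K hK).1.of_exposedFace_subset h hq hk hkd huv.ge).2 i hi
    rw [mul_comm] at h₂
    tauto
  exact (main hF).antisymm (main hF.symm)

/-! ### From faces to normal fans -/

theorem isExposed_exposedFace (C : Set (EuclideanSpace ℝ (Fin d)))
    (y : EuclideanSpace ℝ (Fin d)) : IsExposed ℝ C (exposedFace C y) := by
  intro _
  refine ⟨innerSL ℝ y, ?_⟩
  ext x
  simp [exposedFace, real_inner_comm]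

theorem sUnion_normalFan (C : Set (EuclideanSpace ℝ (Fin d))) : ⋃₀ normalFan C = Set.univ := by
  refine Set.eq_univ_of_forall fun y => ?_
  exact ⟨_, ⟨_, isExposed_exposedFace C y, rfl⟩, subset_closure rfl⟩

theorem fanRefines_of_exposedFace_eq {C D : Set (EuclideanSpace ℝ (Fin d))}
    (h : ∀ y y', exposedFace C y = exposedFace C y' → exposedFace D y = exposedFace D y') :
    FanRefines (normalFan C) (normalFan D) := by
  refine ⟨?_, by rw [sUnion_normalFan, sUnion_normalFan]⟩
  rintro _ ⟨F, -, rfl⟩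
  rcases Set.eq_empty_or_nonempty {y | exposedFace C y = F} with hF | ⟨y, hy⟩
  -- An exposed face such as `∅` may be exposed by no vector; its cone is then empty and lies in any
  -- cone.
  · refine ⟨_, ⟨_, isExposed_exposedFace D 0, rfl⟩, ?_⟩
    rw [normalCone, hF, closure_empty]
    exact Set.empty_subset _
  · refine ⟨_, ⟨_, isExposed_exposedFace D y, rfl⟩, closure_mono fun y' hy' => ?_⟩
    exact h _ _ (hy'.trans hy.symm)

/-! ### Hölder duality and norming vectors -/

theorem lpNorm_top_le_one_iff (x : EuclideanSpace ℝ (Fin d)) :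
    lpNorm ⊤ x ≤ 1 ↔ ∀ i, |x i| ≤ 1 := by
  rw [lpNorm, PiLp.norm_toLp, pi_norm_le_iff_of_nonneg zero_le_one]
  simp

theorem lpNorm_le_one_iff {p : ℝ≥0∞} {r : ℝ} (hr : p.toReal = r) (hp : 0 < r)
    (x : EuclideanSpace ℝ (Fin d)) : lpNorm p x ≤ 1 ↔ ∑ i, |x i| ^ r ≤ 1 := by
  subst hr
  rw [lpNorm, PiLp.norm_eq_sum hp]
  simp only [Real.norm_eq_abs]
  have h0 : 0 ≤ ∑ i, |x i| ^ p.toReal :=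
    Finset.sum_nonneg fun _ _ => Real.rpow_nonneg (abs_nonneg _) _
  constructor
  · intro h
    by_contra! hcon
    exact h.not_gt (Real.one_lt_rpow hcon (by positivity))
  · exact fun h => Real.rpow_le_one h0 h (by positivity)

theorem isLpDual_top : IsLpDual d ⊤ 1 := by
  constructor
  · intro x y K hx
    rw [lpNorm_top_le_one_iff] at hx
    simp only [powSum, div_one, Real.rpow_one]
    refine Finset.sum_le_sum fun i _ => (le_abs_self _).trans ?_
    rw [abs_mul]
    exact mul_le_of_le_one_left (abs_nonneg _) (hx i)
  · intro y K
    refine ⟨WithLp.toLp 2 fun i => if i ∈ K then SignType.sign (y i) else 0, ?_, ?_, ?_, ?_⟩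
    · rw [lpNorm_top_le_one_iff]
      intro i
      rcases lt_trichotomy (y i) 0 with hi | hi | hi <;> by_cases hK : i ∈ K <;> simp [hi, hK]
    · intro i hi
      simp [hi]
    · simp only [powSum, div_one, Real.rpow_one]
      refine Finset.sum_congr rfl fun i hi => ?_
      simp [hi, sign_mul_self]
    · intro i
      by_cases hK : i ∈ K
      · refine ⟨|y i|⁻¹, by positivity, ?_⟩
        rcases lt_trichotomy (y i) 0 with hi | hi | hi
        · simp [hK, hi, abs_of_neg hi, inv_neg, hi.ne]
        · simp [hi]
        · simp [hK, hi, abs_of_pos hi, hi.ne']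
      · exact ⟨0, le_rfl, by simp [hK]⟩

theorem isLpDual_of_holderConjugate {p : ℝ≥0∞} {q : ℝ} (hpq : p.toReal.HolderConjugate q) :
    IsLpDual d p q := by
  obtain ⟨r, hr⟩ : ∃ r, p.toReal = r := ⟨_, rfl⟩
  rw [hr] at hpq
  have hr0 : 0 < r := hpq.pos
  have hq0 : 0 < q := hpq.symm.pos
  constructor
  · intro x y K hx
    rw [lpNorm_le_one_iff hr hr0] at hx
    refine (Real.inner_le_Lp_mul_Lq K _ _ hpq).trans ?_
    refine mul_le_of_le_one_left (Real.rpow_nonneg (powSum_nonneg q y K) _) ?_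
    refine Real.rpow_le_one (powSum_nonneg r x K) ?_ (by positivity)
    exact (powSum_mono r x (Finset.subset_univ K)).trans hx
  · intro y K
    set S := powSum q y K with hS
    have hS0 : 0 ≤ S := powSum_nonneg q y K
    -- If `S = 0`, normalizing is impossible, but `x = 0` already attains the bound.
    rcases hS0.eq_or_lt with hS1 | hS1
    · refine ⟨0, ?_, fun _ _ => rfl, ?_, fun i => ⟨0, le_rfl, by simp⟩⟩
      · rw [lpNorm_le_one_iff hr hr0]
        simp [Real.zero_rpow hr0.ne']
      · rw [← hS1, Real.zero_rpow (by positivity)]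
        simp
    -- Equality case of Hölder: `c i * y i` is `sign (y i) * |y i| ^ (q - 1)`, normalized in `ℓ_r`.
    -- Where `y i = 0` the value of `|y i| ^ (q - 2)` is harmless.
    set c : Fin d → ℝ := fun i => if i ∈ K then |y i| ^ (q - 2) * S ^ (-(1 / r)) else 0 with hc
    have hc0 : ∀ i, 0 ≤ c i := by
      intro i
      simp only [hc]
      split_ifs <;> positivity
    have hpow : ∀ i, |y i| ^ (q - 2) * |y i| * |y i| = |y i| ^ q := by
      intro i
      rcases (abs_nonneg (y i)).eq_or_lt with hi | hi
      · rw [← hi, mul_zero, Real.zero_rpow hq0.ne']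
      · rw [mul_assoc, ← pow_two, ← Real.rpow_natCast, ← Real.rpow_add hi]
        norm_num
    have hpow' : ∀ i, (|y i| ^ (q - 2) * |y i|) ^ r = |y i| ^ q := by
      intro i
      rcases (abs_nonneg (y i)).eq_or_lt with hi | hi
      · rw [← hi, mul_zero, Real.zero_rpow hr0.ne', Real.zero_rpow hq0.ne']
      · have e : |y i| ^ (q - 2) * |y i| = |y i| ^ (q - 1) := by
          nth_rewrite 2 [← Real.rpow_one |y i|]
          rw [← Real.rpow_add hi]
          congr 1
          ring
        rw [e, ← Real.rpow_mul hi.le, hpq.symm.sub_one_mul_conj]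
    refine ⟨WithLp.toLp 2 fun i => c i * y i, ?_, ?_, ?_, fun i => ⟨c i, hc0 i, rfl⟩⟩
    · rw [lpNorm_le_one_iff hr hr0]
      apply le_of_eq
      have hterm : ∀ i, |c i * y i| ^ r = if i ∈ K then S⁻¹ * |y i| ^ q else 0 := by
        intro i
        by_cases hi : i ∈ K
        · have e : |c i * y i| = S ^ (-(1 / r)) * (|y i| ^ (q - 2) * |y i|) := by
            rw [abs_mul, abs_of_nonneg (hc0 i)]
            simp only [hc, if_pos hi]
            ring
          rw [e, Real.mul_rpow (by positivity) (by positivity), hpow', ← Real.rpow_mul hS0,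
            neg_mul, one_div_mul_cancel hr0.ne', Real.rpow_neg_one, if_pos hi]
        · simp [hc, hi, Real.zero_rpow hr0.ne']
      simp only [hterm, Finset.sum_ite_mem, Finset.univ_inter, ← Finset.mul_sum]
      exact inv_mul_cancel₀ hS1.ne'
    · intro i hi
      simp [hc, hi]
    · have hterm : ∀ i ∈ K, c i * y i * y i = S ^ (-(1 / r)) * |y i| ^ q := by
        intro i hi
        rw [← hpow i]
        simp only [hc, if_pos hi]
        rw [mul_assoc _ (|y i|), abs_mul_abs_self]
        ring
      simp only
      rw [Finset.sum_congr rfl hterm, ← Finset.mul_sum]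
      change S ^ (-(1 / r)) * S = S ^ (1 / q)
      nth_rewrite 2 [← Real.rpow_one S]
      rw [← Real.rpow_add hS1]
      congr 1
      have := hpq.inv_add_inv_eq_one
      rw [one_div, one_div]
      linarith

end KSupport

end

theorem mainTheorem10 (d k : ℕ) (hk : 1 ≤ k) (hkd : k ≤ d)
    (p : ENNReal) (hp : 1 < p) (hp' : p < ⊤) :
    KSupport.FanRefines (KSupport.normalFan (KSupport.lpSupportBall d p k))
      (KSupport.normalFan (KSupport.lpSupportBall d ⊤ k)) := by
  have hpq : p.toReal.HolderConjugate p.toReal.conjExponent := by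
    refine Real.HolderConjugate.conjExponent ?_
    rw [← ENNReal.toReal_one]
    exact (ENNReal.toReal_lt_toReal ENNReal.one_ne_top hp'.ne).mpr hp
  exact KSupport.fanRefines_of_exposedFace_eq fun y y' hF =>
    KSupport.exposedFace_top_eq (KSupport.isLpDual_of_holderConjugate hpq) hpq.symm.pos
      KSupport.isLpDual_top hk hkd hF
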